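/- Let $K$ be a field of characteristic zero, let $V$ be a finite-dimensional $K$-vector space, let $\lambda$ be a partition of a positive integer $n$, and let $v_1,\dots,v_n\in V$. A tableau of shape $\lambda$ is a bijective filling of the boxes of the Young diagram of $\lambda$ with the numbers $1,\dots,n$; it is standard if the numbers increase along every row and down every column. For a tableau $T$ let $$a_T=\sum_{\sigma\in\mathrm{Row}(T)}\sigma,\qquad b_T=\sum_{\sigma\in\mathrm{Col}(T)}\operatorname{sign}(\sigma)\,\sigma,\qquad c_T=b_Ta_T\in K\mathfrak S_n,$$ where $\mathrm{Row}(T)$ and $\mathrm{Col}(T)$ are the subgroups of $\mathfrak S_n$ stabilizing every row, respectively every column, of $T$. Let $\chi^\lambda$ be the irreducible character of $\mathfrak S_n$ corresponding to $\lambda$, that is, the character of the right ideal $c_T\,K\mathfrak S_n$ for any tableau $T$ of shape $\lambda$ (it does not depend on $T$), and let $T_\lambda$ be the endomorphism of $V^{\otimes n}$ given by $$(u_1\otimes\cdots\otimes u_n)\,T_\lambda=\frac{\chi^\lambda(1)}{n!}\sum_{\sigma\in\mathfrak S_n}\chi^\lambda(\sigma)\,u_{\sigma(1)}\otimes\cdots\otimes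 u_{\sigma(n)}.$$ Say that the columns of $T$ index linearly independent sets if, for every column of $T$ with set of entries $C$, the family $(v_i)_{i\in C}$ is linearly independent. Then: 1. (Dias da Silva--Fonseca) The symmetrized tensor $(v_1\otimes\cdots\otimes v_n)\,T_\lambda$ is nonzero if and only if there is a standard tableau of shape $\lambda$ whose columns index linearly independent sets. 2. (Gamas's theorem, which part 1 sharpens) It is nonzero if and only if there is any tableau of shape $\lambda$, standard or not, whose columns index linearly independent sets. -/

import Mathlib

open scoped TensorProduct

namespace Young

/-- A tableau of shape `μ` with entries indexed by `Fin n`: a bijective filling of the boxes of the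
Young diagram `μ` by the `n` numbers. Such fillings exist precisely when `μ` has `n` boxes.
A box `c` lies in row `c.1.1` and in column `c.1.2`. -/
abbrev Tableau (μ : YoungDiagram) (n : ℕ) : Type := μ.cells ≃ Fin n

namespace Tableau

variable {μ : YoungDiagram} {n : ℕ}

/-- The row of `T` containing the number `i`. -/
def rowOf (T : Tableau μ n) (i : Fin n) : ℕ := (T.symm i).1.1

/-- The column of `T` containing the number `i`. -/
def colOf (T : Tableau μ n) (i : Fin n) : ℕ := (T.symm i).1.2

/-- A tableau is standard if the numbers increase along each row and down each column. -/
def IsStandard (T : Tableau μ n) : Prop :=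
  (∀ c d : μ.cells, c.1.1 = d.1.1 → c.1.2 < d.1.2 → T c < T d) ∧
  (∀ c d : μ.cells, c.1.2 = d.1.2 → c.1.1 < d.1.1 → T c < T d)

/-- Every column of `T` indexes a linearly independent subfamily of `v`. -/
def ColumnsIndependent (K : Type*) [Field K] {V : Type*} [AddCommGroup V] [Module K V]
    (T : Tableau μ n) (v : Fin n → V) : Prop :=
  ∀ j : ℕ, LinearIndependent K (fun i : {i : Fin n // T.colOf i = j} => v i)

/-- The row group of `T`: the permutations of the numbers that stabilize each row. -/
def rowGroup (T : Tableau μ n) : Subgroup (Equiv.Perm (Fin n)) where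
  carrier := {σ | ∀ i, T.rowOf (σ i) = T.rowOf i}
  one_mem' := fun _ => rfl
  mul_mem' := fun {a b} ha hb i => (ha (b i)).trans (hb i)
  inv_mem' := fun {a} ha i => by simpa using (ha (a⁻¹ i)).symm

/-- The column group of `T`: the permutations of the numbers that stabilize each column. -/
def colGroup (T : Tableau μ n) : Subgroup (Equiv.Perm (Fin n)) where
  carrier := {σ | ∀ i, T.colOf (σ i) = T.colOf i}
  one_mem' := fun _ => rfl
  mul_mem' := fun {a b} ha hb i => (ha (b i)).trans (hb i)
  inv_mem' := fun {a} ha i => by simpa using (ha (a⁻¹ i)).symm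

section Symmetrizers

variable (K : Type*) [Field K]

open Classical in
/-- The row symmetrizer `a_T`. -/
noncomputable def rowSymmetrizer (T : Tableau μ n) : MonoidAlgebra K (Equiv.Perm (Fin n)) :=
  ∑ σ : Equiv.Perm (Fin n) with σ ∈ T.rowGroup, MonoidAlgebra.of K _ σ

open Classical in
/-- The column antisymmetrizer `b_T`. -/
noncomputable def colAntisymmetrizer (T : Tableau μ n) : MonoidAlgebra K (Equiv.Perm (Fin n)) :=
  ∑ σ : Equiv.Perm (Fin n) with σ ∈ T.colGroup,
    ((Equiv.Perm.sign σ : ℤ) : K) • MonoidAlgebra.of K _ σ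

/-- The Young symmetrizer `c_T = b_T a_T`. -/
noncomputable def youngSymmetrizer (T : Tableau μ n) : MonoidAlgebra K (Equiv.Perm (Fin n)) :=
  T.colAntisymmetrizer K * T.rowSymmetrizer K

/-- The right ideal `c_T · K[𝔖ₙ]` generated by the Young symmetrizer, as a `K`-subspace of the group
algebra. -/
noncomputable def rightIdeal (T : Tableau μ n) :
    Submodule K (MonoidAlgebra K (Equiv.Perm (Fin n))) :=
  LinearMap.range (LinearMap.mulLeft K (T.youngSymmetrizer K))

theorem mul_of_mem_rightIdeal (T : Tableau μ n) (σ : Equiv.Perm (Fin n)) :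
    ∀ x ∈ T.rightIdeal K, LinearMap.mulRight K (MonoidAlgebra.of K _ σ) x ∈ T.rightIdeal K := by
  rintro _ ⟨y, rfl⟩
  exact ⟨y * MonoidAlgebra.of K _ σ, by simp [mul_assoc]⟩

/-- Right multiplication by `σ` on the right ideal generated by `c_T`. -/
noncomputable def rightMul (T : Tableau μ n) (σ : Equiv.Perm (Fin n)) :
    T.rightIdeal K →ₗ[K] T.rightIdeal K :=
  (LinearMap.mulRight K (MonoidAlgebra.of K _ σ)).restrict (T.mul_of_mem_rightIdeal K σ)

/-- The character of the right `𝔖ₙ`-module `c_T · K[𝔖ₙ]`. -/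
noncomputable def character (T : Tableau μ n) (σ : Equiv.Perm (Fin n)) : K :=
  LinearMap.trace K (T.rightIdeal K) (T.rightMul K σ)

end Symmetrizers

end Tableau

/-- Some tableau of shape `μ`, for a Young diagram `μ` with `n` boxes. -/
noncomputable def someTableau {n : ℕ} (μ : YoungDiagram) (h : μ.card = n) : Tableau μ n :=
  μ.cells.equivFinOfCardEq h

/-- The irreducible character `χ^μ` of the symmetric group `𝔖ₙ`: the character of the right ideal
generated by the Young symmetrizer of a tableau of shape `μ`. It does not depend on the choice of
that tableau, see `irreducibleCharacter_eq`. -/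
noncomputable def irreducibleCharacter (K : Type*) [Field K] {n : ℕ} (μ : YoungDiagram)
    (h : μ.card = n) (σ : Equiv.Perm (Fin n)) : K :=
  (someTableau μ h).character K σ

section Independence

variable {μ : YoungDiagram} {n : ℕ} (K : Type*) [Field K]

theorem rowSymmetrizer_trans (T : Tableau μ n) (π : Equiv.Perm (Fin n)) :
    Tableau.rowSymmetrizer K (T.trans π) * MonoidAlgebra.of K _ π =
      MonoidAlgebra.of K _ π * Tableau.rowSymmetrizer K T := by
  classical
  unfold Tableau.rowSymmetrizer
  rw [Finset.sum_mul, Finset.mul_sum]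
  refine Finset.sum_bij' (fun σ _ => π⁻¹ * σ * π) (fun σ _ => π * σ * π⁻¹) ?_ ?_ ?_ ?_ ?_
  · intro σ hσ
    rw [Finset.mem_filter] at hσ ⊢
    refine ⟨Finset.mem_univ _, fun i => ?_⟩
    simpa [Tableau.rowOf, Equiv.Perm.inv_def] using hσ.2 (π i)
  · intro σ hσ
    rw [Finset.mem_filter] at hσ ⊢
    refine ⟨Finset.mem_univ _, fun i => ?_⟩
    simpa [Tableau.rowOf, Equiv.Perm.inv_def] using hσ.2 (π⁻¹ i)
  · intro σ _; group
  · intro σ _; group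
  · intro σ _
    rw [← map_mul, ← map_mul]
    congr 1
    group

theorem colAntisymmetrizer_trans (T : Tableau μ n) (π : Equiv.Perm (Fin n)) :
    Tableau.colAntisymmetrizer K (T.trans π) * MonoidAlgebra.of K _ π =
      MonoidAlgebra.of K _ π * Tableau.colAntisymmetrizer K T := by
  classical
  unfold Tableau.colAntisymmetrizer
  rw [Finset.sum_mul, Finset.mul_sum]
  refine Finset.sum_bij' (fun σ _ => π⁻¹ * σ * π) (fun σ _ => π * σ * π⁻¹) ?_ ?_ ?_ ?_ ?_
  · intro σ hσ
    rw [Finset.mem_filter] at hσ ⊢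
    refine ⟨Finset.mem_univ _, fun i => ?_⟩
    simpa [Tableau.colOf, Equiv.Perm.inv_def] using hσ.2 (π i)
  · intro σ hσ
    rw [Finset.mem_filter] at hσ ⊢
    refine ⟨Finset.mem_univ _, fun i => ?_⟩
    simpa [Tableau.colOf, Equiv.Perm.inv_def] using hσ.2 (π⁻¹ i)
  · intro σ _; group
  · intro σ _; group
  · intro σ _
    have hs : Equiv.Perm.sign (π⁻¹ * σ * π) = Equiv.Perm.sign σ := by
      rw [Equiv.Perm.sign_mul, Equiv.Perm.sign_mul, Equiv.Perm.sign_inv, mul_right_comm,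
        Int.units_mul_self, one_mul]
    rw [hs, smul_mul_assoc, mul_smul_comm, ← map_mul, ← map_mul]
    congr 2
    group

theorem youngSymmetrizer_trans (T : Tableau μ n) (π : Equiv.Perm (Fin n)) :
    Tableau.youngSymmetrizer K (T.trans π) * MonoidAlgebra.of K _ π =
      MonoidAlgebra.of K _ π * Tableau.youngSymmetrizer K T := by
  unfold Tableau.youngSymmetrizer
  rw [mul_assoc, rowSymmetrizer_trans, ← mul_assoc, colAntisymmetrizer_trans, mul_assoc]

/-- Left multiplication by a permutation, as a linear automorphism of the group algebra. -/
noncomputable def leftMulEquiv (π : Equiv.Perm (Fin n)) :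
    MonoidAlgebra K (Equiv.Perm (Fin n)) ≃ₗ[K] MonoidAlgebra K (Equiv.Perm (Fin n)) :=
  LinearEquiv.ofLinearMap (LinearMap.mulLeft K (MonoidAlgebra.of K _ π))
    (LinearMap.mulLeft K (MonoidAlgebra.of K _ π⁻¹))
    (by ext1 x; simp [← LinearMap.mulLeft_mul, MonoidAlgebra.single_mul_single,
          ← MonoidAlgebra.one_def])
    (by ext1 x; simp [← LinearMap.mulLeft_mul, MonoidAlgebra.single_mul_single,
          ← MonoidAlgebra.one_def])

theorem rightIdeal_trans (T : Tableau μ n) (π : Equiv.Perm (Fin n)) :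
    (T.rightIdeal K).map (leftMulEquiv K π).toLinearMap =
      Tableau.rightIdeal K (T.trans π) := by
  have h1 : MonoidAlgebra.of K _ π * MonoidAlgebra.of K _ π⁻¹ =
      (1 : MonoidAlgebra K (Equiv.Perm (Fin n))) := by rw [← map_mul, mul_inv_cancel, map_one]
  ext x
  constructor
  · rintro ⟨_, ⟨y, rfl⟩, rfl⟩
    refine ⟨MonoidAlgebra.of K _ π * y, ?_⟩
    change _ * (_ * y) = _ * (_ * y)
    rw [← mul_assoc, youngSymmetrizer_trans, mul_assoc]
  · rintro ⟨y, rfl⟩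
    refine ⟨_, ⟨MonoidAlgebra.of K _ π⁻¹ * y, rfl⟩, ?_⟩
    change _ * (_ * (_ * y)) = _ * y
    rw [← mul_assoc, ← youngSymmetrizer_trans, mul_assoc, ← mul_assoc _ _ y, h1, one_mul]

/-- The character of `c_T · K[𝔖ₙ]` depends only on the shape of `T`. -/
theorem irreducibleCharacter_eq (h : μ.card = n) (T : Tableau μ n) (σ : Equiv.Perm (Fin n)) :
    irreducibleCharacter K μ h σ = T.character K σ := by
  obtain ⟨π, hπ⟩ : ∃ π : Equiv.Perm (Fin n), T = (someTableau μ h).trans π :=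
    ⟨(someTableau μ h).symm.trans T, by ext; simp⟩
  subst hπ
  set S := someTableau μ h with hS
  let e : S.rightIdeal K ≃ₗ[K] Tableau.rightIdeal K (S.trans π) :=
    ((leftMulEquiv K π).submoduleMap (S.rightIdeal K)).trans
      (LinearEquiv.ofEq _ _ (rightIdeal_trans K S π))
  have he : Tableau.rightMul K (S.trans π) σ = e.conj (S.rightMul K σ) := by
    ext1 x
    obtain ⟨y, rfl⟩ := e.surjective x
    rw [LinearEquiv.conj_apply_apply, LinearEquiv.symm_apply_apply]
    apply Subtype.ext
    change (_ * (y : MonoidAlgebra K (Equiv.Perm (Fin n)))) * _ = _ * (_ * _)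
    exact mul_assoc _ _ _
  unfold irreducibleCharacter Tableau.character
  rw [he, LinearMap.trace_conj']

end Independence

section Tensor

variable (K : Type*) [Field K] (V : Type*) [AddCommGroup V] [Module K V]

/-- The right action of `σ ∈ 𝔖ₙ` on `V^{⊗n}` by permuting tensor positions, see
`permTensor_tprod`. -/
noncomputable def permTensor {n : ℕ} (σ : Equiv.Perm (Fin n)) :
    (⨂[K] _ : Fin n, V) →ₗ[K] (⨂[K] _ : Fin n, V) :=
  (PiTensorProduct.reindex K (fun _ : Fin n => V) σ.symm).toLinearMap

theorem permTensor_tprod {n : ℕ} (σ : Equiv.Perm (Fin n)) (v : Fin n → V) :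
    permTensor K V σ (PiTensorProduct.tprod K v) = PiTensorProduct.tprod K (fun i => v (σ i)) := by
  unfold permTensor
  simp

/-- The endomorphism `T_μ = (χ^μ(1) / n!) ∑_σ χ^μ(σ) σ` of `V^{⊗n}`. -/
noncomputable def symmetrizer {n : ℕ} (μ : YoungDiagram) (h : μ.card = n) :
    (⨂[K] _ : Fin n, V) →ₗ[K] (⨂[K] _ : Fin n, V) :=
  (irreducibleCharacter K μ h 1 / (n.factorial : K)) •
    ∑ σ : Equiv.Perm (Fin n), irreducibleCharacter K μ h σ • permTensor K V σ

theorem symmetrizer_tprod {n : ℕ} (μ : YoungDiagram) (h : μ.card = n) (v : Fin n → V) :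
    symmetrizer K V μ h (PiTensorProduct.tprod K v) =
      (irreducibleCharacter K μ h 1 / (n.factorial : K)) •
        ∑ σ : Equiv.Perm (Fin n),
          irreducibleCharacter K μ h σ • PiTensorProduct.tprod K (fun i => v (σ i)) := by
  simp [symmetrizer, permTensor_tprod]

end Tensor

end Young

/-! Up to the nonzero scalar χ(1)/n!, the operator T_λ is the action of the central element z = Σ
χ(σ)σ of the group algebra. A nonzero multiple of z is the sum of the Young symmetrizers c_{gT} over
all relabellings g, and conversely c_T is a scalar multiple of z c_T. Hence T_λ kills a tensor
exactly when every c_T kills it (`symmetrizer_apply_eq_zero_iff`).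

For a decomposable tensor each c_T = b_T a_T can be tested separately
(`act_youngSymmetrizer_ne_zero_iff`). The factor b_T antisymmetrizes over columns, so it kills the
tensor if some column is dependent. If all columns are independent, pair with a product of
functionals, one functional f_r for each row r. This form is invariant under the row group, so a_T
only contributes the factor |Row(T)|. On the column antisymmetrization it is a product of
determinants, one per column. Each is a nonzero polynomial in the f_r, and K is infinite, so some
choice makes them all nonzero. This is Gamas's theorem.

To reach a standard tableau, take one with independent columns that maximizes, lexicographically, Σ
col(i)·i and then Σ row(i)·i. A descent in a column is removed by a swap that raises the second sum.
A descent in a row is removed by a Garnir exchange (`exists_colWeight_lt`) that raises the first: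
too many vectors meet too few functionals, so an alternating sum over exchanges vanishes, and some
exchange that changes the columns must contribute. -/

namespace Young

/-! ### Alternating sums of multilinear maps over a subgroup. -/

section Antisymmetrization

variable {K : Type*} [Field K] {V : Type*} [AddCommGroup V] [Module K V]
  {N : Type*} [AddCommGroup N] [Module K N] {n : ℕ}

open Classical in
/-- The antisymmetrization of a multilinear map over a subgroup of the symmetric group. -/
noncomputable def antisymmetrize (H : Subgroup (Equiv.Perm (Fin n)))
    (L : MultilinearMap K (fun _ : Fin n => V) N) : MultilinearMap K (fun _ : Fin n => V) N :=
  ∑ σ : Equiv.Perm (Fin n) with σ ∈ H, ((Equiv.Perm.sign σ : ℤ) : K) • L.domDomCongr σ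

open Classical in
theorem antisymmetrize_apply (H : Subgroup (Equiv.Perm (Fin n)))
    (L : MultilinearMap K (fun _ : Fin n => V) N) (u : Fin n → V) :
    antisymmetrize H L u =
      ∑ σ : Equiv.Perm (Fin n) with σ ∈ H, ((Equiv.Perm.sign σ : ℤ) : K) • L (fun i => u (σ i)) := by
  simp [antisymmetrize]

/-- The terms of σ and (i k)σ cancel. Pairing them off, rather than deducing x = -x, makes the
argument valid in every characteristic. -/
theorem antisymmetrize_eq_zero_of_eq {H : Subgroup (Equiv.Perm (Fin n))}
    (L : MultilinearMap K (fun _ : Fin n => V) N) {u : Fin n → V} {i k : Fin n} (hik : i ≠ k)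
    (hH : Equiv.swap i k ∈ H) (hu : u i = u k) : antisymmetrize H L u = 0 := by
  classical
  rw [antisymmetrize_apply]
  have hswap : ∀ m, u (Equiv.swap i k m) = u m := by
    intro m
    rw [Equiv.swap_apply_def]
    split_ifs with h1 h2
    · rw [h1, hu]
    · rw [h2, hu]
    · rfl
  refine Finset.sum_involution (fun σ _ => Equiv.swap i k * σ) ?_ ?_ ?_ ?_
  · intro σ _
    simp [hswap, Equiv.Perm.sign_swap hik]
  · intro σ _ _ h
    exact hik (Equiv.swap_eq_one_iff.1 (mul_eq_right.1 h))
  · intro σ hσ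
    rw [Finset.mem_filter] at hσ ⊢
    exact ⟨Finset.mem_univ _, H.mul_mem hH hσ.2⟩
  · intro σ _
    simp

/-- An antisymmetrization vanishes at vectors that are linearly dependent modulo a subspace on
which it vanishes. -/
theorem antisymmetrize_eq_zero {H : Subgroup (Equiv.Perm (Fin n))}
    (L : MultilinearMap K (fun _ : Fin n => V) N) (X : Finset (Fin n))
    (hX : ∀ i ∈ X, ∀ k ∈ X, Equiv.swap i k ∈ H) (W : Submodule K V)
    (hW : ∀ u : Fin n → V, ∀ i ∈ X, u i ∈ W → antisymmetrize H L u = 0)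
    (v : Fin n → V) (c : Fin n → K) {i₀ : Fin n} (hi₀ : i₀ ∈ X) (hc : c i₀ ≠ 0)
    (hv : ∑ i ∈ X, c i • v i ∈ W) : antisymmetrize H L v = 0 := by
  classical
  -- Put the whole combination in position i₀ and expand: every summand other than i₀ repeats a
  -- vector at two positions of X, so only c i₀ times the original value survives.
  have h1 := hW (Function.update v i₀ (∑ i ∈ X, c i • v i)) i₀ hi₀ (by simpa using hv)
  rw [MultilinearMap.map_update_sum, Finset.sum_eq_single_of_mem i₀ hi₀] at h1
  · simpa [hc] using h1
  · intro i hi hne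
    rw [MultilinearMap.map_update_smul,
      antisymmetrize_eq_zero_of_eq L hne (hX i hi i₀ hi₀) (by simp [hne]), smul_zero]

theorem antisymmetrize_comp_perm {H : Subgroup (Equiv.Perm (Fin n))}
    (L : MultilinearMap K (fun _ : Fin n => V) N) (u : Fin n → V) {τ : Equiv.Perm (Fin n)}
    (hτ : τ ∈ H) : antisymmetrize H L (fun i => u (τ i)) =
      ((Equiv.Perm.sign τ : ℤ) : K) • antisymmetrize H L u := by
  classical
  rw [antisymmetrize_apply, antisymmetrize_apply, Finset.smul_sum]
  refine Finset.sum_bij' (fun σ _ => τ * σ) (fun σ _ => τ⁻¹ * σ) ?_ ?_ ?_ ?_ ?_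
  · intro σ hσ
    rw [Finset.mem_filter] at hσ ⊢
    exact ⟨Finset.mem_univ _, H.mul_mem hτ hσ.2⟩
  · intro σ hσ
    rw [Finset.mem_filter] at hσ ⊢
    exact ⟨Finset.mem_univ _, H.mul_mem (H.inv_mem hτ) hσ.2⟩
  · intro σ _; group
  · intro σ _; group
  · intro σ _
    rw [smul_smul, ← Int.cast_mul, Equiv.Perm.sign_mul, Units.val_mul, ← mul_assoc,
      ← Units.val_mul, Int.units_mul_self, Units.val_one, one_mul]
    rfl

end Antisymmetrization

/-! ### Detecting independent columns by functionals attached to rows. -/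

namespace Tableau

variable {K : Type*} [Field K] {V : Type*} [AddCommGroup V] [Module K V]
  {N : Type*} [AddCommGroup N] [Module K N] {n : ℕ} {μ : YoungDiagram}

theorem ext_row_col (T : Tableau μ n) {i k : Fin n} (hr : T.rowOf i = T.rowOf k)
    (hc : T.colOf i = T.colOf k) : i = k :=
  T.symm.injective (Subtype.ext (Prod.ext hr hc))

theorem swap_mem_colGroup (T : Tableau μ n) {i k : Fin n} (h : T.colOf i = T.colOf k) :
    Equiv.swap i k ∈ T.colGroup := by
  intro m
  rw [Equiv.swap_apply_def]
  split_ifs with h1 h2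
  · rw [h1, h]
  · rw [h2, h]
  · rfl

/-- If the column antisymmetrization of a multilinear map does not vanish at `v`, then the columns
index linearly independent families. -/
theorem columnsIndependent_of_antisymmetrize_ne_zero (T : Tableau μ n)
    (L : MultilinearMap K (fun _ : Fin n => V) N) {v : Fin n → V}
    (h : antisymmetrize T.colGroup L v ≠ 0) : T.ColumnsIndependent K v := by
  classical
  intro j
  by_contra hdep
  rw [Fintype.linearIndependent_iff] at hdep
  push Not at hdep
  obtain ⟨g, hg, i₀, hi₀⟩ := hdep
  -- Here the subspace is zero: a linear relation within the column is extended by zero to all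
  -- positions.
  refine h (antisymmetrize_eq_zero L {i | T.colOf i = j} ?_ ⊥ ?_ v
    (fun i => if hi : T.colOf i = j then g ⟨i, hi⟩ else 0) (i₀ := i₀) ?_ ?_ ?_)
  · intro i hi k hk
    simp only [Finset.mem_filter, Finset.mem_univ, true_and] at hi hk
    exact T.swap_mem_colGroup (hi.trans hk.symm)
  · intro u i _ hu
    exact MultilinearMap.map_coord_zero _ i ((Submodule.mem_bot K).1 hu)
  · simp [i₀.2]
  · simpa [i₀.2] using hi₀
  · rw [Submodule.mem_bot, ← hg, ← Finset.sum_subtype_of_mem (p := fun i => T.colOf i = j)]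
    · refine Finset.sum_bij' (fun i _ => i) (fun i _ => i) ?_ ?_ ?_ ?_ ?_ <;> simp
      intro a ha
      simp [ha]
    · simp

/-- The product of linear functionals, the one applied at a position being given by the row of that
position. -/
noncomputable def rowForm (T : Tableau μ n) (f : ℕ → Module.Dual K V) :
    MultilinearMap K (fun _ : Fin n => V) K :=
  (MultilinearMap.mkPiAlgebra K (Fin n) K).compLinearMap (fun i => f (T.rowOf i))

theorem rowForm_apply (T : Tableau μ n) (f : ℕ → Module.Dual K V) (u : Fin n → V) :
    T.rowForm f u = ∏ i, f (T.rowOf i) (u i) := by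
  simp [rowForm]

/-- The matrix, with one diagonal block for each column of the tableau, whose determinant is the
column antisymmetrization of `rowForm`. -/
def blockMatrix {R : Type*} [Zero R] (T : Tableau μ n) (x : ℕ → Fin n → R) :
    Matrix (Fin n) (Fin n) R :=
  Matrix.of fun m i => if T.colOf m = T.colOf i then x (T.rowOf i) m else 0

theorem antisymmetrize_rowForm (T : Tableau μ n) (f : ℕ → Module.Dual K V) (u : Fin n → V) :
    antisymmetrize T.colGroup (T.rowForm f) u =
      (T.blockMatrix fun r m => f r (u m)).det := by
  classical
  rw [antisymmetrize_apply, Matrix.det_apply', Finset.sum_filter]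
  refine Finset.sum_congr rfl fun σ _ => ?_
  split_ifs with h
  · rw [rowForm_apply, smul_eq_mul]
    congr 1
    refine Finset.prod_congr rfl fun i _ => ?_
    simp only [blockMatrix, Matrix.of_apply]
    rw [if_pos (h i)]
  · have : ∃ i, T.colOf (σ i) ≠ T.colOf i := by
      by_contra hcon
      push Not at hcon
      exact h hcon
    obtain ⟨i, hi⟩ := this
    rw [Finset.prod_eq_zero (Finset.mem_univ i), mul_zero]
    simp [blockMatrix, hi]

theorem blockTriangular_blockMatrix {R : Type*} [Zero R] (T : Tableau μ n) (x : ℕ → Fin n → R) :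
    (T.blockMatrix x).BlockTriangular T.colOf := by
  intro m i h
  simp [blockMatrix, h.ne']

/-- A linearly independent column is separated by suitable functionals. -/
theorem exists_dual_of_linearIndependent (T : Tableau μ n) {v : Fin n → V} {j : ℕ}
    (h : LinearIndependent K (fun i : {i : Fin n // T.colOf i = j} => v i)) :
    ∃ f : ℕ → Module.Dual K V, ∀ m i : {i : Fin n // T.colOf i = j},
      f (T.rowOf i) (v m) = if m = i then 1 else 0 := by
  classical
  obtain ⟨g, hg⟩ := LinearMap.exists_extend h.repr
  -- The functional of row r is the coordinate along the unique entry of column j in that row,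
  -- extended to V; rows that do not meet the column get 0.
  refine ⟨fun r => if hr : ∃ i : {i : Fin n // T.colOf i = j}, T.rowOf i = r then
    (Finsupp.lapply hr.choose).comp g else 0, fun m i => ?_⟩
  have hr : ∃ i' : {i : Fin n // T.colOf i = j}, T.rowOf i' = T.rowOf i := ⟨i, rfl⟩
  have hi : hr.choose = i :=
    Subtype.ext (T.ext_row_col hr.choose_spec (hr.choose.2.trans i.2.symm))
  have hgm : g (v m) = Finsupp.single m 1 := by
    have h1 := LinearMap.congr_fun hg ⟨v m, Submodule.subset_span ⟨m, rfl⟩⟩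
    rw [h.repr_eq_single m _ rfl] at h1
    exact h1
  beta_reduce
  rw [dif_pos hr, LinearMap.comp_apply, hgm, hi, Finsupp.lapply_apply, Finsupp.single_apply]

/-- If all columns of a tableau index linearly independent families, then generic functionals
detect this simultaneously. -/
theorem exists_antisymmetrize_rowForm_ne_zero [Infinite K] [FiniteDimensional K V]
    (T : Tableau μ n) {v : Fin n → V} (h : T.ColumnsIndependent K v) :
    ∃ f : ℕ → Module.Dual K V, antisymmetrize T.colGroup (T.rowForm f) v ≠ 0 := by
  classical
  let B := Module.finBasis K V
  -- The value at `v m` of a generic functional of row r, whose coordinates are indeterminates.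
  let x : ℕ → Fin n → MvPolynomial (ℕ × Fin (Module.finrank K V)) K := fun r m =>
    ∑ k, MvPolynomial.X (r, k) * MvPolynomial.C (B.repr (v m) k)
  have hx : ∀ (f : ℕ → Module.Dual K V) r m,
      MvPolynomial.eval (fun p => f p.1 (B p.2)) (x r m) = f r (v m) := by
    intro f r m
    conv_rhs => rw [← B.sum_repr (v m), map_sum]
    simp only [x, map_sum, map_mul, MvPolynomial.eval_X, MvPolynomial.eval_C, map_smul,
      smul_eq_mul, mul_comm]
  -- The determinant factors over columns, and polynomials form a domain, so each block may be
  -- specialized separately. Functionals dual to column j turn its block into the identity, although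
  -- they need not suit the other columns.
  have hdet : (T.blockMatrix x).det ≠ 0 := by
    rw [(T.blockTriangular_blockMatrix x).det, Finset.prod_ne_zero_iff]
    intro j _ h0
    obtain ⟨f, hf⟩ := T.exists_dual_of_linearIndependent (h j)
    have h1 := congrArg (MvPolynomial.eval (fun p => f p.1 (B p.2))) h0
    rw [RingHom.map_det, map_zero] at h1
    have h2 : (MvPolynomial.eval (fun p => f p.1 (B p.2))).mapMatrix
        ((T.blockMatrix x).toSquareBlock T.colOf j) = 1 := by
      ext m i
      simp only [RingHom.mapMatrix_apply, Matrix.map_apply, Matrix.toSquareBlock_def, blockMatrix,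
        Matrix.of_apply, if_pos (m.2.trans i.2.symm), hx, hf, Matrix.one_apply]
    rw [h2, Matrix.det_one] at h1
    exact one_ne_zero h1
  -- A nonzero polynomial over an infinite field has a point where it does not vanish.
  have : ∃ p : ℕ × Fin (Module.finrank K V) → K,
      MvPolynomial.eval p (T.blockMatrix x).det ≠ 0 := by
    by_contra hcon
    push Not at hcon
    exact hdet (MvPolynomial.funext fun p => by rw [hcon p, map_zero])
  obtain ⟨p, hp⟩ := this
  refine ⟨fun r => B.constr K fun k => p (r, k), ?_⟩
  rw [antisymmetrize_rowForm]
  convert hp using 1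
  rw [RingHom.map_det]
  congr 1
  ext m i
  simp only [RingHom.mapMatrix_apply, Matrix.map_apply, blockMatrix, Matrix.of_apply]
  split_ifs
  · rw [← hx fun r => B.constr K fun k => p (r, k)]
    congr 2
    ext q
    simp
  · simp

end Tableau

/-! ### Exchange of entries and passage to a standard tableau. -/

theorem sum_mul_lt_sum_mul_perm {n : ℕ} (f : Fin n → ℤ) (X : Finset (Fin n))
    {τ : Equiv.Perm (Fin n)} (hτ : ∀ i ∉ X, τ i = i)
    (hX : AntivaryOn f (fun i => ((i : ℕ) : ℤ)) X)
    (hn : ¬ AntivaryOn f (fun i => ((τ i : ℕ) : ℤ)) X) :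
    ∑ i, f i * ((i : ℕ) : ℤ) < ∑ i, f i * ((τ i : ℕ) : ℤ) := by
  -- Strict rearrangement inequality: the oppositely ordered arrangement on X is minimal, and
  -- equality holds only for arrangements that are still oppositely ordered.
  have h1 := (hX.sum_mul_lt_sum_mul_comp_perm_iff (σ := τ) (fun x hx => by
    by_contra hcon
    exact hx (hτ x hcon))).2 hn
  rw [← Finset.sum_add_sum_compl X, ← Finset.sum_add_sum_compl X fun i => f i * ((τ i : ℕ) : ℤ)]
  refine add_lt_add_of_lt_of_le h1 (le_of_eq (Finset.sum_congr rfl fun i hi => ?_))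
  rw [hτ i (Finset.mem_compl.1 hi)]

/-- A finite set mapped into itself by a permutation is mapped onto itself. -/
theorem mem_of_apply_mem {α : Type*} (τ : Equiv.Perm α) (A : Finset α) (h : ∀ i ∈ A, τ i ∈ A)
    {i : α} (hi : τ i ∈ A) : i ∈ A := by
  classical
  have hA : A.image τ = A :=
    Finset.eq_of_subset_of_card_le (Finset.image_subset_iff.2 h)
      (Finset.card_image_of_injective A τ.injective).ge
  rw [← hA, Finset.mem_image] at hi
  obtain ⟨k, hk, hki⟩ := hi
  exact τ.injective hki ▸ hk

namespace Tableau

variable {K : Type*} [Field K] {V : Type*} [AddCommGroup V] [Module K V]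
  {n : ℕ} {μ : YoungDiagram}

theorem colOf_trans (T : Tableau μ n) (τ : Equiv.Perm (Fin n)) (i : Fin n) :
    colOf (T.trans τ) i = T.colOf (τ.symm i) := rfl

theorem rowOf_trans (T : Tableau μ n) (τ : Equiv.Perm (Fin n)) (i : Fin n) :
    rowOf (T.trans τ) i = T.rowOf (τ.symm i) := rfl

theorem rowOf_apply (T : Tableau μ n) (c : μ.cells) : T.rowOf (T c) = c.1.1 := by simp [rowOf]

theorem colOf_apply (T : Tableau μ n) (c : μ.cells) : T.colOf (T c) = c.1.2 := by simp [colOf]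

theorem rowOf_lt_colLen (T : Tableau μ n) (i : Fin n) : T.rowOf i < μ.colLen (T.colOf i) :=
  YoungDiagram.mem_iff_lt_colLen.1 ((YoungDiagram.mem_cells _).1 (T.symm i).2)

theorem exists_rowOf_colOf (T : Tableau μ n) {r j : ℕ} (h : r < μ.colLen j) :
    ∃ i, T.rowOf i = r ∧ T.colOf i = j := by
  have hc : (r, j) ∈ μ.cells := (YoungDiagram.mem_cells _).2 (YoungDiagram.mem_iff_lt_colLen.2 h)
  exact ⟨T ⟨(r, j), hc⟩, T.rowOf_apply _, T.colOf_apply _⟩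

theorem ColumnsIndependent.trans {T : Tableau μ n} {v : Fin n → V} {τ : Equiv.Perm (Fin n)}
    (h : T.ColumnsIndependent K (fun i => v (τ i))) : ColumnsIndependent K (T.trans τ) v := by
  intro j
  have h1 := (h j).comp
    (fun i : {i : Fin n // colOf (T.trans τ) i = j} => ⟨τ.symm i, i.2⟩) (fun a b hab => by
      simpa [Subtype.ext_iff] using hab)
  simpa [Function.comp_def] using h1

/-- The weighted sum of the column indices of the entries. -/
def colWeight (T : Tableau μ n) : ℤ := ∑ i, (T.colOf i : ℤ) * ((i : ℕ) : ℤ)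

/-- The weighted sum of the row indices of the entries. -/
def rowWeight (T : Tableau μ n) : ℤ := ∑ i, (T.rowOf i : ℤ) * ((i : ℕ) : ℤ)

theorem colWeight_trans (T : Tableau μ n) (τ : Equiv.Perm (Fin n)) :
    colWeight (T.trans τ) = ∑ i, (T.colOf i : ℤ) * ((τ i : ℕ) : ℤ) := by
  unfold colWeight
  rw [← Equiv.sum_comp τ]
  simp [colOf_trans]

theorem rowWeight_trans (T : Tableau μ n) (τ : Equiv.Perm (Fin n)) :
    rowWeight (T.trans τ) = ∑ i, (T.rowOf i : ℤ) * ((τ i : ℕ) : ℤ) := by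
  unfold rowWeight
  rw [← Equiv.sum_comp τ]
  simp [rowOf_trans]

/-- Two entries of a column that are out of order can be exchanged. -/
theorem exists_rowWeight_lt (T : Tableau μ n) {v : Fin n → V} (hT : T.ColumnsIndependent K v)
    {x y : Fin n} (hc : T.colOf x = T.colOf y) (hr : T.rowOf x < T.rowOf y) (hxy : y < x) :
    ∃ T' : Tableau μ n, T'.ColumnsIndependent K v ∧ T'.colWeight = T.colWeight ∧
      T.rowWeight < T'.rowWeight := by
  have hcol : colOf (T.trans (Equiv.swap x y)) = T.colOf :=
    funext fun i => T.swap_mem_colGroup hc i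
  refine ⟨T.trans (Equiv.swap x y), ?_, ?_, ?_⟩
  · unfold ColumnsIndependent
    rw [hcol]
    exact hT
  · unfold colWeight
    rw [hcol]
  · rw [rowWeight_trans]
    refine sum_mul_lt_sum_mul_perm (fun i => (T.rowOf i : ℤ)) {x, y} ?_ ?_ ?_
    · intro i hi
      simp only [Finset.mem_insert, Finset.mem_singleton, not_or] at hi
      exact Equiv.swap_apply_of_ne_of_ne hi.1 hi.2
    · intro i hi k hk hik
      simp only [Finset.coe_insert, Finset.coe_singleton, Set.mem_insert_iff,
        Set.mem_singleton_iff] at hi hk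
      simp only [Nat.cast_lt, Nat.cast_le] at hik ⊢
      rcases hi with rfl | rfl <;> rcases hk with rfl | rfl <;> omega
    · intro h
      have h1 := h (i := x) (by simp) (j := y) (by simp)
      simp only [Equiv.swap_apply_left, Equiv.swap_apply_right, Nat.cast_lt, Nat.cast_le] at h1
      exact absurd (h1 hxy) (not_le.2 hr)

/-- Exchange between two columns, from a Garnir relation: if an entry of a row is larger than a
later entry of that row, then the larger entries of the one column and the smaller entries of the
other can be redistributed. -/
theorem exists_colWeight_lt [CharZero K] [FiniteDimensional K V] (T : Tableau μ n)
    {v : Fin n → V} (hT : T.ColumnsIndependent K v)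
    (hstd : ∀ c d : μ.cells, c.1.2 = d.1.2 → c.1.1 < d.1.1 → T c < T d)
    {x y : Fin n} (hr : T.rowOf x = T.rowOf y) (hc : T.colOf x < T.colOf y) (hxy : y < x) :
    ∃ T' : Tableau μ n, T'.ColumnsIndependent K v ∧ T.colWeight < T'.colWeight := by
  classical
  obtain ⟨f, hf⟩ := T.exists_antisymmetrize_rowForm_ne_zero hT
  set r := T.rowOf x with hr'
  set j := T.colOf x with hj
  set k := T.colOf y with hk
  have hmono : ∀ p q, T.colOf p = T.colOf q → T.rowOf p ≤ T.rowOf q → p ≤ q := by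
    intro p q h1 h2
    rcases h2.eq_or_lt with h2 | h2
    · exact (T.ext_row_col h2 h1).le
    · simpa using (hstd (T.symm p) (T.symm q) h1 h2).le
  -- The Garnir sets: A runs from x to the bottom of its column, B from the top of its column to y.
  -- Since columns increase, every entry of B is at most y < x, hence smaller than every entry of A.
  -- Together they have one entry more than column j has boxes.
  let A : Finset (Fin n) := {i | T.colOf i = j ∧ r ≤ T.rowOf i}
  let B : Finset (Fin n) := {i | T.colOf i = k ∧ T.rowOf i ≤ r}
  have memA : ∀ i, i ∈ A ↔ T.colOf i = j ∧ r ≤ T.rowOf i := by simp [A]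
  have memB : ∀ i, i ∈ B ↔ T.colOf i = k ∧ T.rowOf i ≤ r := by simp [B]
  have hA : ∀ i ∈ A, x ≤ i := fun i hi => hmono x i ((memA i).1 hi).1.symm ((memA i).1 hi).2
  have hB : ∀ i ∈ B, i ≤ y := fun i hi => hmono i y ((memB i).1 hi).1
    (((memB i).1 hi).2.trans hr.le)
  have hAB : Disjoint A B := by
    rw [Finset.disjoint_left]
    intro i hi hi'
    exact absurd (hxy.trans_le (hA i hi)) (not_lt.2 (hB i hi'))
  have hlen : μ.colLen k ≤ μ.colLen j := μ.colLen_anti _ _ hc.le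
  have hrj : r < μ.colLen j := T.rowOf_lt_colLen x
  have hrk : r < μ.colLen k := hr ▸ T.rowOf_lt_colLen y
  have cardA : μ.colLen j - r ≤ A.card := by
    rw [← Nat.card_Ico]
    refine (Finset.card_le_card fun s hs => ?_).trans (Finset.card_image_le (f := T.rowOf))
    rw [Finset.mem_Ico] at hs
    obtain ⟨i, h1, h2⟩ := T.exists_rowOf_colOf hs.2
    exact Finset.mem_image.2 ⟨i, (memA i).2 ⟨h2, h1 ▸ hs.1⟩, h1⟩
  have cardB : r + 1 ≤ B.card := by
    rw [← Finset.card_range (r + 1)]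
    refine (Finset.card_le_card fun s hs => ?_).trans (Finset.card_image_le (f := T.rowOf))
    rw [Finset.mem_range, Nat.lt_succ_iff] at hs
    obtain ⟨i, h1, h2⟩ := T.exists_rowOf_colOf (hs.trans_lt hrk)
    exact Finset.mem_image.2 ⟨i, (memB i).2 ⟨h2, h1 ▸ hs⟩, h1⟩
  let X : Finset (Fin n) := A ∪ B
  have hcard : μ.colLen j < X.card := by
    rw [Finset.card_union_of_disjoint hAB]
    omega
  have hXrow : ∀ i ∈ X, ∀ m, T.colOf m = T.colOf i → T.rowOf m < μ.colLen j := by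
    intro i hi m hm
    have h1 := T.rowOf_lt_colLen m
    rcases Finset.mem_union.1 hi with hi | hi
    · rwa [hm, ((memA i).1 hi).1] at h1
    · rw [hm, ((memB i).1 hi).1] at h1
      exact h1.trans_le hlen
  let H : Subgroup (Equiv.Perm (Fin n)) := fixingSubgroup _ ((X : Set (Fin n))ᶜ)
  have memH : ∀ τ, τ ∈ H ↔ ∀ i ∉ X, τ i = i := fun τ => by
    simp [H, mem_fixingSubgroup_iff]
  have hHX : ∀ τ ∈ H, ∀ i ∈ X, τ i ∈ X := by
    intro τ hτ i hi
    by_contra hcon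
    exact hcon (by rwa [τ.injective ((memH τ).1 hτ _ hcon)])
  -- Positions in columns j and k only meet the functionals of the first `μ.colLen j` rows, so the
  -- vectors indexed by X matter only through their images in a space of that dimension, where they
  -- are dependent.
  let F : V →ₗ[K] (Fin (μ.colLen j) → K) := LinearMap.pi fun s => f s
  have hdep : ¬ LinearIndependent K (fun i : X => F (v i)) := by
    intro h
    have h1 := h.fintype_card_le_finrank
    rw [Module.finrank_fin_fun, Fintype.card_coe] at h1
    omega
  rw [Fintype.linearIndependent_iff] at hdep
  push Not at hdep
  obtain ⟨g, hg, i₀, hi₀⟩ := hdep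
  have hzero : antisymmetrize H (antisymmetrize T.colGroup (T.rowForm f)) v = 0 := by
    refine antisymmetrize_eq_zero _ X ?_ (LinearMap.ker F) ?_ v
      (fun i => if hi : i ∈ X then g ⟨i, hi⟩ else 0) i₀.2 (by simpa using hi₀) ?_
    · intro p hp q hq
      rw [memH]
      intro i hi
      exact Equiv.swap_apply_of_ne_of_ne (fun h => hi (h ▸ hp)) (fun h => hi (h ▸ hq))
    -- After rearranging by τ and σ, the vector `u i` still sits in a column meeting X, so it is
    -- evaluated by one of the functionals making up F, which kills it.
    · intro u i hi hu
      rw [antisymmetrize_apply]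
      refine Finset.sum_eq_zero fun τ hτ => ?_
      rw [Finset.mem_filter] at hτ
      rw [antisymmetrize_apply, Finset.sum_eq_zero, smul_zero]
      intro σ hσ
      rw [Finset.mem_filter] at hσ
      rw [rowForm_apply, Finset.prod_eq_zero (Finset.mem_univ (σ⁻¹ (τ⁻¹ i))), smul_zero]
      have h1 : T.colOf (σ⁻¹ (τ⁻¹ i)) = T.colOf (τ⁻¹ i) :=
        (T.colGroup.inv_mem hσ.2) _
      have h2 := hXrow _ (hHX _ (H.inv_mem hτ.2) i hi) _ h1
      have h3 := congrFun (LinearMap.mem_ker.1 hu) ⟨_, h2⟩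
      simpa [F] using h3
    · rw [LinearMap.mem_ker, map_sum, ← hg, ← Finset.sum_attach]
      simp
  -- Each τ that preserves the columns contributes the same nonzero value, the two signs cancelling.
  -- If all other terms vanished, the sum would be a positive multiple of that value, which is
  -- impossible in characteristic zero.
  have hex : ∃ τ ∈ H, τ ∉ T.colGroup ∧
      antisymmetrize T.colGroup (T.rowForm f) (fun i => v (τ i)) ≠ 0 := by
    by_contra hcon
    push Not at hcon
    rw [antisymmetrize_apply] at hzero
    have h1 : ∀ τ ∈ Finset.univ.filter (fun τ => τ ∈ H),
        ((Equiv.Perm.sign τ : ℤ) : K) •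
          antisymmetrize T.colGroup (T.rowForm f) (fun i => v (τ i)) =
        if τ ∈ T.colGroup then antisymmetrize T.colGroup (T.rowForm f) v else 0 := by
      intro τ hτ
      split_ifs with h
      · rw [antisymmetrize_comp_perm _ _ h, smul_smul, ← Int.cast_mul, ← Units.val_mul,
          Int.units_mul_self, Units.val_one, Int.cast_one, one_smul]
      · rw [hcon τ (Finset.mem_filter.1 hτ).2 h, smul_zero]
    rw [Finset.sum_congr rfl h1, ← Finset.sum_filter, Finset.sum_const, nsmul_eq_mul,
      mul_eq_zero, Nat.cast_eq_zero, Finset.card_eq_zero] at hzero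
    rcases hzero with h | h
    · have : (1 : Equiv.Perm (Fin n)) ∈ (∅ : Finset (Equiv.Perm (Fin n))) := by
        rw [← h]
        simp [H.one_mem, T.colGroup.one_mem]
      simp at this
    · exact hf h
  obtain ⟨τ, hτ, hτQ, hne⟩ := hex
  refine ⟨T.trans τ, (T.columnsIndependent_of_antisymmetrize_ne_zero _ hne).trans, ?_⟩
  rw [colWeight_trans]
  -- On X the larger entries are in the left column, so T minimizes the column weight among
  -- rearrangements of X.
  refine sum_mul_lt_sum_mul_perm (fun i => (T.colOf i : ℤ)) X ((memH τ).1 hτ) ?_ ?_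
  · intro p hp q hq hpq
    simp only [Nat.cast_lt, Nat.cast_le, Fin.val_fin_lt] at hpq ⊢
    rcases Finset.mem_union.1 hp with hp | hp <;> rcases Finset.mem_union.1 hq with hq | hq
    · rw [((memA p).1 hp).1, ((memA q).1 hq).1]
    · exact absurd (hpq.trans_le (hB q hq)) (not_lt.2 (hxy.le.trans (hA p hp)))
    · rw [((memB p).1 hp).1, ((memA q).1 hq).1]
      exact hc.le
    · rw [((memB p).1 hp).1, ((memB q).1 hq).1]
  · have hm : ∃ m ∈ X, T.colOf (τ m) ≠ T.colOf m := by
      by_contra hcon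
      push Not at hcon
      refine hτQ fun i => ?_
      by_cases hi : i ∈ X
      · exact hcon i hi
      · rw [(memH τ).1 hτ i hi]
    obtain ⟨m, hmX, hm⟩ := hm
    -- As τ moves some entry of X to the other column, it sends some p of A into B and, by counting,
    -- some q of B into A. Then τ p < τ q although p is in the column further left, so the opposite
    -- order is broken.
    have hA' : ∃ p ∈ A, τ p ∈ B := by
      by_contra hcon
      push Not at hcon
      have hst : ∀ p ∈ A, τ p ∈ A := fun p hp =>
        (Finset.mem_union.1 (hHX τ hτ p (Finset.mem_union_left _ hp))).resolve_right (hcon p hp)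
      rcases Finset.mem_union.1 hmX with h | h
      · exact hm (((memA _).1 (hst m h)).1.trans ((memA m).1 h).1.symm)
      · rcases Finset.mem_union.1 (hHX τ hτ m hmX) with h' | h'
        · exact Finset.disjoint_left.1 hAB (mem_of_apply_mem τ A hst h') h
        · exact hm (((memB _).1 h').1.trans ((memB m).1 h).1.symm)
    have hB' : ∃ q ∈ B, τ q ∈ A := by
      by_contra hcon
      push Not at hcon
      have hst : ∀ p ∈ B, τ p ∈ B := fun p hp =>
        (Finset.mem_union.1 (hHX τ hτ p (Finset.mem_union_right _ hp))).resolve_left (hcon p hp)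
      obtain ⟨p, hp, hp'⟩ := hA'
      exact Finset.disjoint_left.1 hAB hp (mem_of_apply_mem τ B hst hp')
    obtain ⟨p, hp, hp'⟩ := hA'
    obtain ⟨q, hq, hq'⟩ := hB'
    intro h
    have h1 := h (Finset.mem_coe.2 (Finset.mem_union_left B hp))
      (Finset.mem_coe.2 (Finset.mem_union_right A hq))
    simp only [Nat.cast_lt, Nat.cast_le, Fin.val_fin_lt] at h1
    have h2 := h1 ((hB _ hp').trans_lt (hxy.trans_le (hA _ hq')))
    rw [((memA p).1 hp).1, ((memB q).1 hq).1] at h2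
    omega

/-- If some tableau has columns indexing linearly independent families, then so does some standard
tableau of the same shape. -/
theorem exists_isStandard [CharZero K] [FiniteDimensional K V] {v : Fin n → V}
    (T : Tableau μ n) (hT : T.ColumnsIndependent K v) :
    ∃ T : Tableau μ n, T.IsStandard ∧ T.ColumnsIndependent K v := by
  classical
  -- The column weight comes first: the Garnir exchange may disorder the columns, while the swap
  -- within a column leaves the column weight alone.
  obtain ⟨S, hS, hmax⟩ := Set.exists_max_image {T : Tableau μ n | T.ColumnsIndependent K v}
    (fun T => toLex (T.colWeight, T.rowWeight)) (Set.toFinite _) ⟨T, hT⟩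
  have hcol : ∀ c d : μ.cells, c.1.2 = d.1.2 → c.1.1 < d.1.1 → S c < S d := by
    intro c d h1 h2
    by_contra hcon
    have hne : S d ≠ S c := fun h => by
      rw [S.injective h] at h2
      exact h2.false
    obtain ⟨T', hT', h3, h4⟩ := S.exists_rowWeight_lt hS (x := S c) (y := S d)
      (by simpa [colOf_apply] using h1) (by simpa [rowOf_apply] using h2)
      (lt_of_le_of_ne (not_lt.1 hcon) hne)
    exact absurd (hmax T' hT') (not_le.2 (Prod.Lex.toLex_lt_toLex.2 (Or.inr ⟨h3.symm, h4⟩)))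
  refine ⟨S, ⟨fun c d h1 h2 => ?_, hcol⟩, hS⟩
  by_contra hcon
  have hne : S d ≠ S c := fun h => by
    rw [S.injective h] at h2
    exact h2.false
  obtain ⟨T', hT', h3⟩ := S.exists_colWeight_lt hS hcol (x := S c) (y := S d)
    (by simpa [rowOf_apply] using h1) (by simpa [colOf_apply] using h2)
    (lt_of_le_of_ne (not_lt.1 hcon) hne)
  exact absurd (hmax T' hT') (not_le.2 (Prod.Lex.toLex_lt_toLex.2 (Or.inl h3)))

end Tableau

/-! ### Traces, conjugates and central elements in a group algebra. -/

section GroupAlgebra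

variable {K : Type*} [Field K] {G : Type*} [Group G]

theorem monoidAlgebra_induction {p : MonoidAlgebra K G → Prop} (x : MonoidAlgebra K G)
    (zero : p 0) (add : ∀ x y, p x → p y → p (x + y))
    (smul_of : ∀ (g : G) (r : K), p (r • MonoidAlgebra.of K G g)) : p x := by
  refine MonoidAlgebra.induction_linear x zero add fun g r => ?_
  simpa using smul_of g r

theorem coeff_mul_of (x : MonoidAlgebra K G) (g h : G) :
    (x * MonoidAlgebra.of K G g).coeff h = x.coeff (h * g⁻¹) := by
  rw [MonoidAlgebra.of_apply, MonoidAlgebra.coeff_mul_single_eq_coeff_mul (h * g⁻¹), mul_one]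
  intro m _
  rw [eq_mul_inv_iff_mul_eq]

/-- The linear extension of inversion to the group algebra. -/
noncomputable def inversion : MonoidAlgebra K G →ₗ[K] MonoidAlgebra K G :=
  (MonoidAlgebra.basis G K).constr K fun g => MonoidAlgebra.of K G g⁻¹

theorem inversion_of (g : G) :
    inversion (MonoidAlgebra.of K G g) = MonoidAlgebra.of K G g⁻¹ :=
  (MonoidAlgebra.basis G K).constr_basis K _ g

variable [Fintype G]

theorem sum_coeff_smul_of (x : MonoidAlgebra K G) :
    ∑ g, x.coeff g • MonoidAlgebra.of K G g = x := by
  conv_rhs => rw [← (MonoidAlgebra.basis G K).sum_repr x]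
  rfl

theorem trace_eq_sum_coeff (f : MonoidAlgebra K G →ₗ[K] MonoidAlgebra K G) :
    LinearMap.trace K _ f = ∑ g, (f (MonoidAlgebra.of K G g)).coeff g := by
  classical
  rw [LinearMap.trace_eq_matrix_trace K (MonoidAlgebra.basis G K), Matrix.trace]
  refine Finset.sum_congr rfl fun g _ => ?_
  rw [Matrix.diag_apply, LinearMap.toMatrix_apply]
  rfl

/-- The sum of all conjugates of an element of the group algebra. -/
noncomputable def conjugateSum (x : MonoidAlgebra K G) : MonoidAlgebra K G :=
  ∑ g : G, MonoidAlgebra.of K G g⁻¹ * x * MonoidAlgebra.of K G g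

theorem conjugateSum_of_mul (h : G) (y : MonoidAlgebra K G) :
    conjugateSum (MonoidAlgebra.of K G h * y) = conjugateSum (y * MonoidAlgebra.of K G h) := by
  unfold conjugateSum
  rw [← Equiv.sum_comp (Equiv.mulLeft h)]
  refine Finset.sum_congr rfl fun g _ => ?_
  rw [Equiv.coe_mulLeft, map_mul, mul_inv_rev, map_mul]
  simp only [mul_assoc]
  rw [← mul_assoc (MonoidAlgebra.of K G h⁻¹), ← map_mul, inv_mul_cancel, map_one, one_mul]

theorem conjugateSum_add (x y : MonoidAlgebra K G) :
    conjugateSum (x + y) = conjugateSum x + conjugateSum y := by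
  simp [conjugateSum, mul_add, add_mul, Finset.sum_add_distrib]

theorem conjugateSum_smul (r : K) (x : MonoidAlgebra K G) :
    conjugateSum (r • x) = r • conjugateSum x := by
  simp only [conjugateSum, mul_smul_comm, smul_mul_assoc, Finset.smul_sum]

/-- Summing over conjugates behaves like a trace. This is what later makes b_T a_T and a_T b_T
interchangeable. -/
theorem conjugateSum_mul_comm (x y : MonoidAlgebra K G) :
    conjugateSum (x * y) = conjugateSum (y * x) := by
  induction x using monoidAlgebra_induction with
  | zero => simp
  | add x z hx hz => rw [add_mul, mul_add, conjugateSum_add, conjugateSum_add, hx, hz]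
  | smul_of g r =>
    rw [smul_mul_assoc, mul_smul_comm, conjugateSum_smul, conjugateSum_smul, conjugateSum_of_mul]

theorem conjugateSum_mem_center (x y : MonoidAlgebra K G) :
    conjugateSum x * y = y * conjugateSum x := by
  induction y using monoidAlgebra_induction with
  | zero => simp
  | add y z hy hz => rw [add_mul, mul_add, hy, hz]
  | smul_of h r =>
    rw [smul_mul_assoc, mul_smul_comm]
    congr 1
    unfold conjugateSum
    rw [← Equiv.sum_comp (Equiv.mulRight h), Finset.sum_mul, Finset.mul_sum,
      ← Equiv.sum_comp (Equiv.mulRight h⁻¹)]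
    refine Finset.sum_congr rfl fun g _ => ?_
    simp only [Equiv.coe_mulRight, inv_mul_cancel_right, mul_inv_rev, map_mul]
    simp only [mul_assoc]
    rw [← mul_assoc (MonoidAlgebra.of K G h) (MonoidAlgebra.of K G h⁻¹),
      ← map_mul (MonoidAlgebra.of K G) h h⁻¹, mul_inv_cancel, map_one, one_mul]

theorem inversion_eq_sum (x : MonoidAlgebra K G) :
    inversion x = ∑ g, x.coeff g • MonoidAlgebra.of K G g⁻¹ := by
  conv_lhs => rw [← sum_coeff_smul_of x, map_sum]
  simp only [map_smul, inversion_of]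

/-- The class function obtained by averaging the coefficients of an element. -/
theorem sum_conjugate_coeff_smul_of (x : MonoidAlgebra K G) :
    ∑ s : G, (∑ g : G, x.coeff (g * s⁻¹ * g⁻¹)) • MonoidAlgebra.of K G s =
      conjugateSum (inversion x) := by
  simp only [Finset.sum_smul]
  rw [Finset.sum_comm, conjugateSum]
  refine Finset.sum_congr rfl fun g _ => ?_
  rw [inversion_eq_sum, Finset.mul_sum, Finset.sum_mul]
  refine Finset.sum_bij' (fun s _ => g * s⁻¹ * g⁻¹) (fun t _ => g⁻¹ * t⁻¹ * g) ?_ ?_ ?_ ?_ ?_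
  · simp
  · simp
  · intro s _; group
  · intro s _; group
  · intro s _
    rw [mul_smul_comm, smul_mul_assoc, ← map_mul, ← map_mul]
    congr 2
    group

end GroupAlgebra

/-! ### Young symmetrizers and the character they define. -/

namespace Tableau

variable {n : ℕ} {μ : YoungDiagram}

theorem swap_mem_rowGroup (T : Tableau μ n) {i k : Fin n} (h : T.rowOf i = T.rowOf k) :
    Equiv.swap i k ∈ T.rowGroup := by
  intro m
  rw [Equiv.swap_apply_def]
  split_ifs with h1 h2
  · rw [h1, h]
  · rw [h2, h]
  · rfl

/-- Moving every entry within its column to the row from which `g` takes it is possible. -/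
theorem rowOf_inv_colOf_mem (T : Tableau μ n) (g : Equiv.Perm (Fin n))
    (h : ∀ i k, i ≠ k → T.rowOf i = T.rowOf k → T.colOf (g i) ≠ T.colOf (g k)) (m : Fin n) :
    (T.rowOf (g⁻¹ m), T.colOf m) ∈ μ.cells := by
  classical
  let F : Fin n → ℕ × ℕ := fun m => (T.rowOf (g⁻¹ m), T.colOf m)
  have hF : Function.Injective F := by
    intro a b hab
    by_contra hne
    refine h (g⁻¹ a) (g⁻¹ b) (fun h => hne (g⁻¹.injective h)) (Prod.ext_iff.1 hab).1 ?_
    simpa using (Prod.ext_iff.1 hab).2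
  let N : Finset (ℕ × ℕ) := Finset.univ.image F
  have hcells : μ.cells = Finset.univ.image fun m => (T.rowOf m, T.colOf m) := by
    ext c
    simp only [Finset.mem_image, Finset.mem_univ, true_and]
    constructor
    · intro hc
      exact ⟨T ⟨c, hc⟩, by rw [rowOf_apply, colOf_apply]⟩
    · rintro ⟨m, rfl⟩
      exact (T.symm m).2
  have hinj : Function.Injective fun m => (T.rowOf m, T.colOf m) := fun a b hab =>
    T.ext_row_col (Prod.ext_iff.1 hab).1 (Prod.ext_iff.1 hab).2
  have hcard : N.card = μ.cells.card := by
    rw [hcells, Finset.card_image_of_injective _ hF, Finset.card_image_of_injective _ hinj]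
  -- This weight is negative exactly on the boxes of μ. Its sum over the new positions N equals its
  -- sum over μ, because rows are only permuted and columns are kept. A box of μ missing from N
  -- would make the sum over N strictly larger.
  let δ : ℕ × ℕ → ℤ := fun c => (c.1 : ℤ) - μ.colLen c.2
  have hsum : ∑ c ∈ N, δ c = ∑ c ∈ μ.cells, δ c := by
    rw [hcells, Finset.sum_image hF.injOn, Finset.sum_image hinj.injOn]
    simp only [F, δ, Finset.sum_sub_distrib]
    rw [Equiv.sum_comp g⁻¹ fun m => (T.rowOf m : ℤ)]
  have hsub : μ.cells ⊆ N := by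
    by_contra hcon
    rw [← Finset.sdiff_nonempty] at hcon
    have h1 : ∑ c ∈ μ.cells \ N, δ c < 0 := by
      refine Finset.sum_neg (fun c hc => ?_) hcon
      have := YoungDiagram.mem_iff_lt_colLen.1
        ((YoungDiagram.mem_cells (c.1, c.2)).1 (Finset.mem_sdiff.1 hc).1)
      simp only [δ]
      omega
    have h2 : 0 ≤ ∑ c ∈ N \ μ.cells, δ c := by
      refine Finset.sum_nonneg fun c hc => ?_
      have : ¬ c.1 < μ.colLen c.2 := fun hlt => (Finset.mem_sdiff.1 hc).2
        ((YoungDiagram.mem_cells (c.1, c.2)).2 (YoungDiagram.mem_iff_lt_colLen.2 hlt))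
      simp only [δ]
      omega
    have h3 := Finset.sum_sdiff_sub_sum_sdiff (s₁ := N) (s₂ := μ.cells) (f := δ)
    rw [hsum] at h3
    linarith
  rw [Finset.eq_of_subset_of_card_le hsub hcard.le]
  exact Finset.mem_image_of_mem F (Finset.mem_univ m)

/-- Von Neumann's criterion. Moving each m within its column to the row of g⁻¹ m is a column
permutation π, and π g preserves rows, so g = π⁻¹(π g). -/
theorem exists_eq_col_mul_row (T : Tableau μ n) (g : Equiv.Perm (Fin n))
    (h : ∀ i k, i ≠ k → T.rowOf i = T.rowOf k → T.colOf (g i) ≠ T.colOf (g k)) :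
    ∃ q ∈ T.colGroup, ∃ p ∈ T.rowGroup, g = q * p := by
  let F : Fin n → Fin n := fun m => T ⟨_, T.rowOf_inv_colOf_mem g h m⟩
  have hrow : ∀ m, T.rowOf (F m) = T.rowOf (g⁻¹ m) := fun m => T.rowOf_apply _
  have hcol : ∀ m, T.colOf (F m) = T.colOf m := fun m => T.colOf_apply _
  have hF : Function.Injective F := by
    intro a b hab
    by_contra hne
    refine h (g⁻¹ a) (g⁻¹ b) (fun h => hne (g⁻¹.injective h)) ?_ ?_
    · rw [← hrow, ← hrow, hab]
    · simpa using (hcol a).symm.trans ((congrArg T.colOf hab).trans (hcol b))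
  let π : Equiv.Perm (Fin n) := Equiv.ofBijective F (Finite.injective_iff_bijective.1 hF)
  refine ⟨π⁻¹, T.colGroup.inv_mem fun m => hcol m, π * g, fun i => ?_, by group⟩
  change T.rowOf (F (g i)) = _
  rw [hrow]
  simp

section Symmetrizers

variable (K : Type*) [Field K]

theorem of_mul_rowSymmetrizer (T : Tableau μ n) {p : Equiv.Perm (Fin n)} (hp : p ∈ T.rowGroup) :
    MonoidAlgebra.of K _ p * T.rowSymmetrizer K = T.rowSymmetrizer K := by
  classical
  unfold rowSymmetrizer
  rw [Finset.mul_sum]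
  refine Finset.sum_bij' (fun σ _ => p * σ) (fun σ _ => p⁻¹ * σ) ?_ ?_ ?_ ?_ ?_
  · intro σ hσ
    rw [Finset.mem_filter] at hσ ⊢
    exact ⟨Finset.mem_univ _, T.rowGroup.mul_mem hp hσ.2⟩
  · intro σ hσ
    rw [Finset.mem_filter] at hσ ⊢
    exact ⟨Finset.mem_univ _, T.rowGroup.mul_mem (T.rowGroup.inv_mem hp) hσ.2⟩
  · intro σ _; group
  · intro σ _; group
  · intro σ _
    rw [map_mul]

theorem colAntisymmetrizer_mul_of (T : Tableau μ n) {q : Equiv.Perm (Fin n)}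
    (hq : q ∈ T.colGroup) :
    T.colAntisymmetrizer K * MonoidAlgebra.of K _ q =
      ((Equiv.Perm.sign q : ℤ) : K) • T.colAntisymmetrizer K := by
  classical
  unfold colAntisymmetrizer
  rw [Finset.sum_mul, Finset.smul_sum]
  refine Finset.sum_bij' (fun σ _ => σ * q) (fun σ _ => σ * q⁻¹) ?_ ?_ ?_ ?_ ?_
  · intro σ hσ
    rw [Finset.mem_filter] at hσ ⊢
    exact ⟨Finset.mem_univ _, T.colGroup.mul_mem hσ.2 hq⟩
  · intro σ hσ
    rw [Finset.mem_filter] at hσ ⊢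
    exact ⟨Finset.mem_univ _, T.colGroup.mul_mem hσ.2 (T.colGroup.inv_mem hq)⟩
  · intro σ _; group
  · intro σ _; group
  · intro σ _
    rw [smul_mul_assoc, ← map_mul, smul_smul, ← Int.cast_mul, ← Units.val_mul,
      Equiv.Perm.sign_mul, mul_left_comm, Int.units_mul_self, mul_one]

/-- Everything between the column antisymmetrizer and the row symmetrizer is absorbed into a
scalar. -/
theorem exists_col_mul_mul_row [CharZero K] (T : Tableau μ n)
    (x : MonoidAlgebra K (Equiv.Perm (Fin n))) :
    ∃ k : K, T.colAntisymmetrizer K * x * T.rowSymmetrizer K = k • T.youngSymmetrizer K := by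
  induction x using monoidAlgebra_induction with
  | zero => exact ⟨0, by simp⟩
  | add x y hx hy =>
    obtain ⟨k, hk⟩ := hx
    obtain ⟨l, hl⟩ := hy
    exact ⟨k + l, by rw [mul_add, add_mul, hk, hl, add_smul]⟩
  | smul_of g r =>
    suffices h : ∃ k : K, T.colAntisymmetrizer K * MonoidAlgebra.of K _ g * T.rowSymmetrizer K =
        k • T.youngSymmetrizer K by
      obtain ⟨k, hk⟩ := h
      exact ⟨r * k, by rw [mul_smul_comm, smul_mul_assoc, hk, smul_smul]⟩
    by_cases h : ∀ i k, i ≠ k → T.rowOf i = T.rowOf k → T.colOf (g i) ≠ T.colOf (g k)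
    · obtain ⟨q, hq, p, hp, rfl⟩ := T.exists_eq_col_mul_row g h
      refine ⟨((Equiv.Perm.sign q : ℤ) : K), ?_⟩
      rw [map_mul, ← mul_assoc, colAntisymmetrizer_mul_of K T hq, mul_assoc,
        of_mul_rowSymmetrizer K T hp, smul_mul_assoc]
      rfl
    · push Not at h
      obtain ⟨i, k, hik, hr, hc⟩ := h
      refine ⟨0, ?_⟩
      -- The transposition (i k) is absorbed by a_T; carried across g it becomes a column
      -- transposition, which b_T turns into a sign.
      have h1 : T.colAntisymmetrizer K * MonoidAlgebra.of K _ g * T.rowSymmetrizer K =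
          -(T.colAntisymmetrizer K * MonoidAlgebra.of K _ g * T.rowSymmetrizer K) := by
        conv_lhs => rw [← of_mul_rowSymmetrizer K T (T.swap_mem_rowGroup hr), ← mul_assoc,
          mul_assoc (T.colAntisymmetrizer K), ← map_mul, Equiv.mul_swap_eq_swap_mul, map_mul,
          ← mul_assoc, colAntisymmetrizer_mul_of K T (T.swap_mem_colGroup hc),
          Equiv.Perm.sign_swap (g.injective.ne hik)]
        simp
      rw [zero_smul]
      have h2 := eq_neg_iff_add_eq_zero.1 h1
      rw [← two_smul K, smul_eq_zero] at h2
      exact h2.resolve_left two_ne_zero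

theorem exists_young_mul_mul_young [CharZero K] (T : Tableau μ n)
    (x : MonoidAlgebra K (Equiv.Perm (Fin n))) :
    ∃ k : K, T.youngSymmetrizer K * x * T.youngSymmetrizer K = k • T.youngSymmetrizer K := by
  obtain ⟨k, hk⟩ := T.exists_col_mul_mul_row K (T.rowSymmetrizer K * x * T.colAntisymmetrizer K)
  exact ⟨k, by rw [← hk]; simp only [youngSymmetrizer, mul_assoc]⟩

open Classical in
theorem youngSymmetrizer_eq_sum (T : Tableau μ n) :
    T.youngSymmetrizer K = ∑ q : Equiv.Perm (Fin n) with q ∈ T.colGroup,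
      ∑ p : Equiv.Perm (Fin n) with p ∈ T.rowGroup,
        ((Equiv.Perm.sign q : ℤ) : K) • MonoidAlgebra.of K _ (q * p) := by
  simp only [youngSymmetrizer, colAntisymmetrizer, rowSymmetrizer, Finset.sum_mul_sum,
    smul_mul_assoc, map_mul]

/-- The identity arises only as 1·1, since a permutation preserving both rows and columns fixes
every box. Integrality is what later permits a positivity argument over an arbitrary field of
characteristic zero. -/
theorem exists_coeff_youngSymmetrizer (T : Tableau μ n) :
    ∃ z : Equiv.Perm (Fin n) → ℤ, z 1 = 1 ∧ ∀ σ, (T.youngSymmetrizer K).coeff σ = z σ := by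
  classical
  refine ⟨fun σ => ∑ q : Equiv.Perm (Fin n) with q ∈ T.colGroup,
      ∑ p : Equiv.Perm (Fin n) with p ∈ T.rowGroup,
        if q * p = σ then (Equiv.Perm.sign q : ℤ) else 0, ?_, fun σ => ?_⟩
  · beta_reduce
    rw [Finset.sum_eq_single_of_mem 1 (by simp [T.colGroup.one_mem]),
      Finset.sum_eq_single_of_mem 1 (by simp [T.rowGroup.one_mem])]
    · simp
    · intro p _ hp
      simp [hp]
    · intro q hq hne
      refine Finset.sum_eq_zero fun p hp => if_neg fun h => hne ?_
      have hp' := T.rowGroup.inv_mem (Finset.mem_filter.1 hp).2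
      rw [← eq_inv_iff_mul_eq_one] at h
      rw [← h] at hp'
      exact Equiv.ext fun i => T.ext_row_col (hp' i) ((Finset.mem_filter.1 hq).2 i)
  · rw [youngSymmetrizer_eq_sum]
    simp [MonoidAlgebra.coeff_sum, Finsupp.finsetSum_apply, Finsupp.single_apply]

theorem inversion_youngSymmetrizer (T : Tableau μ n) :
    inversion (T.youngSymmetrizer K) = T.rowSymmetrizer K * T.colAntisymmetrizer K := by
  classical
  rw [youngSymmetrizer_eq_sum]
  simp only [map_sum, map_smul, inversion_of, mul_inv_rev]
  unfold colAntisymmetrizer rowSymmetrizer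
  rw [Finset.sum_mul_sum, Finset.sum_comm]
  refine Finset.sum_bij' (fun σ _ => σ⁻¹) (fun σ _ => σ⁻¹) ?_ ?_ ?_ ?_ ?_
  · simp
  · simp
  · simp
  · simp
  intro p _
  refine Finset.sum_bij' (fun σ _ => σ⁻¹) (fun σ _ => σ⁻¹) ?_ ?_ ?_ ?_ ?_
  · simp
  · simp
  · simp
  · simp
  intro q _
  rw [mul_smul_comm, map_mul, Equiv.Perm.sign_inv]

theorem exists_young_mul_young [CharZero K] (T : Tableau μ n) :
    ∃ κ : K, κ ≠ 0 ∧
      T.youngSymmetrizer K * T.youngSymmetrizer K = κ • T.youngSymmetrizer K := by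
  obtain ⟨κ, hκ⟩ := T.exists_young_mul_mul_young K 1
  rw [mul_one] at hκ
  refine ⟨κ, ?_, hκ⟩
  rintro rfl
  -- If c_T squared to zero, left multiplication by c_T would have trace 0; but the trace is n!
  -- times the coefficient of c_T at the identity, that is n!.
  have hnil : IsNilpotent (LinearMap.mulLeft K (T.youngSymmetrizer K)) :=
    ⟨2, by
      rw [pow_two, Module.End.mul_eq_comp, ← LinearMap.mulLeft_mul, hκ, zero_smul,
        LinearMap.mulLeft_zero_eq_zero]⟩
  have htr := (LinearMap.isNilpotent_trace_of_isNilpotent hnil).eq_zero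
  obtain ⟨z, hz1, hz⟩ := T.exists_coeff_youngSymmetrizer K
  rw [trace_eq_sum_coeff] at htr
  simp [-MonoidAlgebra.of_apply, coeff_mul_of, hz, hz1, Nat.factorial_ne_zero,
    Fintype.card_perm] at htr

/-- The map x ↦ c_T x σ sends the whole algebra into the ideal and acts there as κ times right
multiplication by σ. Its trace can therefore be computed on the basis of permutations. -/
theorem smul_character [CharZero K] (T : Tableau μ n) {κ : K}
    (h : T.youngSymmetrizer K * T.youngSymmetrizer K = κ • T.youngSymmetrizer K)
    (σ : Equiv.Perm (Fin n)) :
    κ * T.character K σ = ∑ g, (T.youngSymmetrizer K).coeff (g * σ⁻¹ * g⁻¹) := by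
  let f : MonoidAlgebra K (Equiv.Perm (Fin n)) →ₗ[K] MonoidAlgebra K (Equiv.Perm (Fin n)) :=
    LinearMap.mulRight K (MonoidAlgebra.of K _ σ) ∘ₗ LinearMap.mulLeft K (T.youngSymmetrizer K)
  have hf : ∀ x, f x ∈ T.rightIdeal K := fun x => T.mul_of_mem_rightIdeal K σ _ ⟨x, rfl⟩
  have hres : f.restrict (p := T.rightIdeal K) (q := T.rightIdeal K) (fun x _ => hf x) =
      κ • T.rightMul K σ := by
    ext1 ⟨_, y, rfl⟩
    apply Subtype.ext
    change T.youngSymmetrizer K * (T.youngSymmetrizer K * y) * MonoidAlgebra.of K _ σ =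
      κ • (T.youngSymmetrizer K * y * MonoidAlgebra.of K _ σ)
    rw [← mul_assoc, h, smul_mul_assoc, smul_mul_assoc]
  have htr := LinearMap.trace_restrict_eq_of_forall_mem (T.rightIdeal K) f hf
  rw [hres, map_smul, smul_eq_mul, trace_eq_sum_coeff] at htr
  unfold character
  rw [htr]
  refine Finset.sum_congr rfl fun g _ => ?_
  change (T.youngSymmetrizer K * MonoidAlgebra.of K _ g * MonoidAlgebra.of K _ σ).coeff g = _
  rw [coeff_mul_of, coeff_mul_of]

/-- The element of the group algebra whose coefficients are the values of the character. -/
noncomputable def characterElement (T : Tableau μ n) : MonoidAlgebra K (Equiv.Perm (Fin n)) :=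
  ∑ σ, T.character K σ • MonoidAlgebra.of K _ σ

/-- The trace formula reads coefficients at inverses, giving the conjugate sum of a_T b_T, the
inversion of c_T; by the trace property this equals that of c_T = b_T a_T. -/
theorem smul_characterElement [CharZero K] (T : Tableau μ n) {κ : K}
    (h : T.youngSymmetrizer K * T.youngSymmetrizer K = κ • T.youngSymmetrizer K) :
    κ • T.characterElement K = conjugateSum (T.youngSymmetrizer K) := by
  unfold characterElement
  simp only [Finset.smul_sum, smul_smul, T.smul_character K h]
  rw [sum_conjugate_coeff_smul_of, inversion_youngSymmetrizer, conjugateSum_mul_comm]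
  rfl

theorem conjugateSum_youngSymmetrizer (T : Tableau μ n) :
    conjugateSum (T.youngSymmetrizer K) =
      ∑ g : Equiv.Perm (Fin n), youngSymmetrizer K (T.trans g⁻¹) := by
  unfold conjugateSum
  refine Finset.sum_congr rfl fun g _ => ?_
  rw [← youngSymmetrizer_trans, mul_assoc, ← map_mul, inv_mul_cancel, map_one, mul_one]

theorem characterElement_mul_comm [CharZero K] (T : Tableau μ n)
    (x : MonoidAlgebra K (Equiv.Perm (Fin n))) :
    T.characterElement K * x = x * T.characterElement K := by
  obtain ⟨κ, hκ, h⟩ := T.exists_young_mul_young K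
  have h1 := conjugateSum_mem_center (T.youngSymmetrizer K) x
  rw [← T.smul_characterElement K h, smul_mul_assoc, mul_smul_comm] at h1
  exact smul_right_injective _ hκ h1

theorem character_one_ne_zero [CharZero K] (T : Tableau μ n) : T.character K 1 ≠ 0 := by
  obtain ⟨κ, hκ, h⟩ := T.exists_young_mul_young K
  obtain ⟨z, hz1, hz⟩ := T.exists_coeff_youngSymmetrizer K
  have h1 := T.smul_character K h 1
  intro h0
  simp [h0, hz, hz1, Fintype.card_perm] at h1
  exact Nat.factorial_ne_zero n (by exact_mod_cast h1.symm)

/-- If the product were 0, the central element z = Σ χ(σ)σ would act as zero on the ideal, and the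
trace Σ χ(σ)² of this action would vanish. But κχ(σ) is an integer for each σ, and n! at σ = 1, so
κ² times the trace is a sum of integer squares that is not zero. -/
theorem youngSymmetrizer_mul_characterElement_ne_zero [CharZero K] (T : Tableau μ n) :
    T.youngSymmetrizer K * T.characterElement K ≠ 0 := by
  intro h0
  obtain ⟨κ, hκ, h⟩ := T.exists_young_mul_young K
  obtain ⟨z, hz1, hz⟩ := T.exists_coeff_youngSymmetrizer K
  have h1 : ∑ σ, T.character K σ • T.rightMul K σ = 0 := by
    ext1 ⟨_, y, rfl⟩
    apply Subtype.ext
    rw [LinearMap.sum_apply, AddSubmonoidClass.coe_finsetSum]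
    change ∑ σ, T.character K σ • (T.youngSymmetrizer K * y * MonoidAlgebra.of K _ σ) = 0
    simp only [← mul_smul_comm]
    rw [← Finset.mul_sum]
    change T.youngSymmetrizer K * y * T.characterElement K = 0
    rw [mul_assoc, ← characterElement_mul_comm, ← mul_assoc, h0, zero_mul]
  have h2 := congrArg (fun f => κ * κ * LinearMap.trace K _ f) h1
  simp only [map_sum, map_smul, map_zero, mul_zero, smul_eq_mul, Finset.mul_sum] at h2
  have h3 : ∀ σ, κ * κ * (T.character K σ * LinearMap.trace K _ (T.rightMul K σ)) =
      (((∑ g, z (g * σ⁻¹ * g⁻¹)) ^ 2 : ℤ) : K) := by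
    intro σ
    have h4 := T.smul_character K h σ
    simp only [hz, ← Int.cast_sum] at h4
    rw [Int.cast_pow, ← h4]
    unfold character
    ring
  simp only [h3, ← Int.cast_sum] at h2
  rw [Int.cast_eq_zero, Finset.sum_eq_zero_iff_of_nonneg fun σ _ => sq_nonneg _] at h2
  have h5 := h2 1 (Finset.mem_univ _)
  simp [hz1, Nat.factorial_ne_zero, Fintype.card_perm] at h5

/-- With z the character element, c_T z c_T is some k c_T by absorption and κ c_T z by centrality.
As c_T z ≠ 0, also k ≠ 0, and the equation can be solved for c_T. -/
theorem exists_youngSymmetrizer_eq [CharZero K] (T : Tableau μ n) :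
    ∃ s : K, T.youngSymmetrizer K =
      s • (T.characterElement K * T.youngSymmetrizer K) := by
  obtain ⟨κ, hκ, h⟩ := T.exists_young_mul_young K
  obtain ⟨k, hk⟩ := T.exists_young_mul_mul_young K (T.characterElement K)
  rw [mul_assoc, characterElement_mul_comm, ← mul_assoc, h, smul_mul_assoc] at hk
  have hk0 : k ≠ 0 := by
    rintro rfl
    rw [zero_smul, smul_eq_zero] at hk
    exact hk.elim hκ (T.youngSymmetrizer_mul_characterElement_ne_zero K)
  refine ⟨k⁻¹ * κ, ?_⟩
  rw [characterElement_mul_comm, mul_smul, hk, smul_smul, inv_mul_cancel₀ hk0, one_smul]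

end Symmetrizers

end Tableau

/-! ### The right action of the group algebra on tensors. -/

section RightAction

variable (K : Type*) [Field K] (V : Type*) [AddCommGroup V] [Module K V] {n : ℕ}

theorem permTensor_mul (σ τ : Equiv.Perm (Fin n)) :
    permTensor K V (σ * τ) = permTensor K V τ ∘ₗ permTensor K V σ := by
  refine PiTensorProduct.ext (MultilinearMap.ext fun u => ?_)
  simp [permTensor_tprod]

theorem permTensor_one : permTensor K V (1 : Equiv.Perm (Fin n)) = LinearMap.id := by
  refine PiTensorProduct.ext (MultilinearMap.ext fun u => ?_)
  simp [permTensor_tprod]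

/-- The right action of the group algebra on the tensor power by permuting tensor positions. -/
noncomputable def rightAction : MonoidAlgebra K (Equiv.Perm (Fin n)) →ₐ[K]
    (Module.End K (⨂[K] _ : Fin n, V))ᵐᵒᵖ :=
  MonoidAlgebra.lift K _ _
    { toFun := fun σ => MulOpposite.op (permTensor K V σ)
      map_one' := by rw [permTensor_one]; rfl
      map_mul' := fun σ τ => by rw [permTensor_mul]; rfl }

variable {V}

/-- The result of letting an element of the group algebra act on a tensor from the right. -/
noncomputable def act (w : ⨂[K] _ : Fin n, V) :
    MonoidAlgebra K (Equiv.Perm (Fin n)) →ₗ[K] (⨂[K] _ : Fin n, V) where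
  toFun x := (rightAction K V x).unop w
  map_add' x y := by simp
  map_smul' r x := by simp

theorem act_of (w : ⨂[K] _ : Fin n, V) (σ : Equiv.Perm (Fin n)) :
    act K w (MonoidAlgebra.of K _ σ) = permTensor K V σ w := by
  change (rightAction K V (MonoidAlgebra.of K _ σ)).unop w = _
  rw [rightAction, MonoidAlgebra.lift_of]
  rfl

theorem act_mul (w : ⨂[K] _ : Fin n, V) (x y : MonoidAlgebra K (Equiv.Perm (Fin n))) :
    act K w (x * y) = act K (act K w x) y := by
  change (rightAction K V (x * y)).unop w = _
  rw [map_mul]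
  rfl

theorem act_zero_left (x : MonoidAlgebra K (Equiv.Perm (Fin n))) :
    act K (0 : ⨂[K] _ : Fin n, V) x = 0 :=
  map_zero (rightAction K V x).unop

end RightAction

namespace Tableau

variable {K : Type*} [Field K] {V : Type*} [AddCommGroup V] [Module K V] {n : ℕ}
  {μ : YoungDiagram}

theorem act_colAntisymmetrizer (T : Tableau μ n) (v : Fin n → V) :
    act K (PiTensorProduct.tprod K v) (T.colAntisymmetrizer K) =
      antisymmetrize T.colGroup (PiTensorProduct.tprod K (s := fun _ : Fin n => V)) v := by
  classical
  rw [antisymmetrize_apply, colAntisymmetrizer, map_sum]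
  simp only [map_smul, act_of, permTensor_tprod]

/-- Permuting positions within rows only reorders the factors of the product form, so every term of
a_T gives the same value. -/
theorem lift_rowForm_act_rowSymmetrizer (T : Tableau μ n) (f : ℕ → Module.Dual K V)
    (w : ⨂[K] _ : Fin n, V) :
    PiTensorProduct.lift (T.rowForm f) (act K w (T.rowSymmetrizer K)) =
      (Nat.card T.rowGroup : K) * PiTensorProduct.lift (T.rowForm f) w := by
  classical
  have hinv : ∀ σ ∈ T.rowGroup, PiTensorProduct.lift (T.rowForm f) ∘ₗ permTensor K V σ =
      PiTensorProduct.lift (T.rowForm f) := by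
    intro σ hσ
    refine PiTensorProduct.ext (MultilinearMap.ext fun u => ?_)
    simp only [LinearMap.compMultilinearMap_apply, LinearMap.comp_apply, permTensor_tprod,
      PiTensorProduct.lift.tprod, rowForm_apply]
    rw [← Equiv.prod_comp σ fun i => f (T.rowOf i) (u i)]
    refine Finset.prod_congr rfl fun i _ => ?_
    rw [hσ i]
  rw [rowSymmetrizer, map_sum, map_sum, Finset.sum_congr rfl fun σ hσ => ?_, Finset.sum_const,
    nsmul_eq_mul, Nat.card_eq_fintype_card, Fintype.card_subtype]
  rw [act_of]
  exact LinearMap.congr_fun (hinv σ (Finset.mem_filter.1 hσ).2) w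

/-- The Young symmetrizer of a tableau does not annihilate a decomposable tensor if and only if the
columns of the tableau index linearly independent families. -/
theorem act_youngSymmetrizer_ne_zero_iff [CharZero K] [FiniteDimensional K V] (T : Tableau μ n)
    (v : Fin n → V) : act K (PiTensorProduct.tprod K v) (T.youngSymmetrizer K) ≠ 0 ↔
      T.ColumnsIndependent K v := by
  classical
  rw [youngSymmetrizer, act_mul, act_colAntisymmetrizer]
  constructor
  · intro h
    refine T.columnsIndependent_of_antisymmetrize_ne_zero
      (PiTensorProduct.tprod K (s := fun _ : Fin n => V)) fun h0 => h ?_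
    rw [h0, act_zero_left]
  · intro h h0
    obtain ⟨f, hf⟩ := T.exists_antisymmetrize_rowForm_ne_zero h
    have h1 := congrArg (PiTensorProduct.lift (T.rowForm f)) h0
    rw [lift_rowForm_act_rowSymmetrizer, map_zero, mul_eq_zero] at h1
    refine h1.elim (Nat.cast_ne_zero.2 Nat.card_pos.ne') fun h2 => hf ?_
    rw [← h2, antisymmetrize_apply, antisymmetrize_apply, map_sum]
    simp only [map_smul, PiTensorProduct.lift.tprod]

end Tableau

/-! ### Reduction of the symmetrizer to Young symmetrizers. -/

section Main

variable {K : Type*} [Field K] [CharZero K] {V : Type*} [AddCommGroup V] [Module K V] {n : ℕ}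
  {μ : YoungDiagram}

omit [CharZero K] in
theorem symmetrizer_apply_eq (h : μ.card = n) (T : Tableau μ n) (w : ⨂[K] _ : Fin n, V) :
    symmetrizer K V μ h w =
      (T.character K 1 / (n.factorial : K)) • act K w (T.characterElement K) := by
  simp only [symmetrizer, Tableau.characterElement, irreducibleCharacter_eq K h T, map_sum,
    map_smul, act_of, LinearMap.smul_apply, LinearMap.sum_apply]

/-- Each c_T is a multiple of z c_T, so a tensor killed by z is killed by c_T. Conversely κz, with κ
≠ 0, is a sum of Young symmetrizers of tableaux of the same shape. -/
theorem symmetrizer_apply_eq_zero_iff (h : μ.card = n) (w : ⨂[K] _ : Fin n, V) :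
    symmetrizer K V μ h w = 0 ↔ ∀ T : Tableau μ n, act K w (T.youngSymmetrizer K) = 0 := by
  have key : ∀ T : Tableau μ n,
      symmetrizer K V μ h w = 0 ↔ act K w (T.characterElement K) = 0 := fun T => by
    rw [symmetrizer_apply_eq h T, smul_eq_zero, or_iff_right (div_ne_zero
      (T.character_one_ne_zero K) (Nat.cast_ne_zero.2 n.factorial_ne_zero))]
  constructor
  · intro h0 T
    obtain ⟨s, hs⟩ := T.exists_youngSymmetrizer_eq K
    rw [hs, map_smul, act_mul, (key T).1 h0, act_zero_left, smul_zero]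
  · intro h0
    let T := someTableau μ h
    rw [key T]
    obtain ⟨κ, hκ, hc⟩ := T.exists_young_mul_young K
    have h1 := congrArg (act K w) (T.smul_characterElement K hc)
    rw [T.conjugateSum_youngSymmetrizer K, map_smul, map_sum,
      Finset.sum_eq_zero fun g _ => h0 _] at h1
    exact (smul_eq_zero.1 h1).resolve_left hκ

theorem symmetrizer_tprod_ne_zero_iff [FiniteDimensional K V] (h : μ.card = n) (v : Fin n → V) :
    symmetrizer K V μ h (PiTensorProduct.tprod K v) ≠ 0 ↔
      ∃ T : Tableau μ n, T.ColumnsIndependent K v := by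
  rw [Ne, symmetrizer_apply_eq_zero_iff, not_forall]
  exact exists_congr fun T => T.act_youngSymmetrizer_ne_zero_iff v

end Main

end Young

theorem mainTheorem3 {K : Type*} [Field K] [CharZero K]
    {V : Type*} [AddCommGroup V] [Module K V] [FiniteDimensional K V]
    {n : ℕ} (hn : 0 < n) (μ : YoungDiagram) (hμ : μ.card = n) (v : Fin n → V) :
    (Young.symmetrizer K V μ hμ (PiTensorProduct.tprod K v) ≠ 0 ↔
      ∃ T : Young.Tableau μ n, T.IsStandard ∧ T.ColumnsIndependent K v) ∧
    (Young.symmetrizer K V μ hμ (PiTensorProduct.tprod K v) ≠ 0 ↔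
      ∃ T : Young.Tableau μ n, T.ColumnsIndependent K v) := by
  rw [Young.symmetrizer_tprod_ne_zero_iff]
  exact ⟨⟨fun ⟨T, hT⟩ => T.exists_isStandard hT, fun ⟨T, _, hT⟩ => ⟨T, hT⟩⟩, Iff.rfl⟩
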